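/- Let $\mathbb K=\mathbb C$ or $\mathbb K=\mathbb R$; in what follows, ``manifold'', ``smooth'' and ``diffeomorphism'' mean complex manifold, holomorphic and biholomorphic map if $\mathbb K=\mathbb C$, and $C^\infty$ manifold, $C^\infty$ and $C^\infty$ diffeomorphism if $\mathbb K=\mathbb R$. Let $M$ be a finite-dimensional manifold with a structure of conic symplectic manifold, that is, a smooth $1$-form $\omega_M$ on $M$ whose differential $\sigma_M=d\omega_M$ is non-degenerate at every point (hence a symplectic form). Let $\theta$ be the Euler vector field of $M$, defined by $\sigma_M(\theta,\cdot)=\omega_M$. Let $\mathcal F$ be a conic lagrangian foliation of $M$, that is, a smooth foliation (given by a foliated atlas) whose leaves are lagrangian (the tangent space of the leaf at each point is equal to its own $\sigma_M$-orthogonal) and conic ($\theta$ is tangent to the leaves). Let $q$ be the codimension of $\mathcal F$. Then for each point $x_0\in M$ there are a ($q$-dimensional, Hausdorff, second countable) manifold $X$, an open neighbourhood $U$ of $x_0$ in $M$ and a homogeneous symplectic map $\varphi:U\to T^*X$, that is, a diffeomorphism $\varphi$ of $U$ onto an open subset of the cotangent bundle $T^*X$ such that $\varphi^*\omega_X=\omega_M|_U$,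 where $\omega_X$ is the canonical (Liouville) $1$-form of $T^*X$, which transforms the leaves into the fibres of $\pi:T^*X\to X$: for each $x\in U$, if $L_x$ is the leaf through $x$ of the foliation induced by $\mathcal F$ on $U$, then $$\varphi(L_x)=\varphi(U)\cap\pi^{-1}\bigl(\pi(\varphi(x))\bigr).$$ -/

import Mathlib

universe u

open Set Topology Bundle
open scoped Manifold ContDiff

/-!
Throughout, `𝕜` is `ℝ` or `ℂ`.  For `𝕜 = ℂ` the class `C^∞` (over `ℂ`) is the class of holomorphic
maps, so that "`C^∞` manifold over `ℂ`" means complex manifold; for `𝕜 = ℝ` one gets the real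
differentiable case.
-/

/-- The cotangent bundle `T*X` of a manifold `X` modelled on `V`: the bundle of continuous linear
forms on the tangent spaces, with its vector bundle and manifold structure from Mathlib. -/
abbrev CotangentBundle (𝕜 : Type*) [RCLike 𝕜] (V : Type*) [NormedAddCommGroup V] [NormedSpace 𝕜 V]
    (X : Type*) [TopologicalSpace X] [ChartedSpace V X] [IsManifold 𝓘(𝕜, V) ∞ X] : Type _ :=
  TotalSpace (V →L[𝕜] 𝕜) (fun x : X => TangentSpace 𝓘(𝕜, V) x →L[𝕜] Trivial X 𝕜 x)

namespace CotangentBundle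

variable {𝕜 : Type*} [RCLike 𝕜] {V : Type*} [NormedAddCommGroup V] [NormedSpace 𝕜 V]
  {X : Type*} [TopologicalSpace X] [ChartedSpace V X] [IsManifold 𝓘(𝕜, V) ∞ X]

/-- The projection `π : T*X → X`. -/
def proj (ξ : CotangentBundle 𝕜 V X) : X := ξ.1

/-- The canonical (Liouville) `1`-form of `T*X`: at the covector `ξ` it is `v ↦ ξ (dπ v)`. -/
noncomputable def canonicalForm (ξ : CotangentBundle 𝕜 V X) :
    TangentSpace (𝓘(𝕜, V).prod 𝓘(𝕜, V →L[𝕜] 𝕜)) ξ →L[𝕜] 𝕜 :=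
  ContinuousLinearMap.comp (M₂ := TangentSpace 𝓘(𝕜, V) (proj ξ)) ξ.2
    (mfderiv (𝓘(𝕜, V).prod 𝓘(𝕜, V →L[𝕜] 𝕜)) 𝓘(𝕜, V) (proj : CotangentBundle 𝕜 V X → X) ξ)

end CotangentBundle

section OneForms

variable {𝕜 : Type*} [RCLike 𝕜] {E : Type*} [NormedAddCommGroup E] [NormedSpace 𝕜 E]
  {M : Type*} [TopologicalSpace M] [ChartedSpace E M]

/-- The expression of a `1`-form on `M` in a chart `c`, i.e. its pull-back by `c⁻¹`. -/
noncomputable def oneFormInChart (α : (x : M) → TangentSpace 𝓘(𝕜, E) x →L[𝕜] 𝕜)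
    (c : OpenPartialHomeomorph M E) (y : E) : E →L[𝕜] 𝕜 :=
  ContinuousLinearMap.comp (M₂ := TangentSpace 𝓘(𝕜, E) (c.symm y)) (α (c.symm y))
    (mfderiv 𝓘(𝕜, E) 𝓘(𝕜, E) c.symm y)

/-- The exterior derivative of a `1`-form on `M`, computed at `x` in the chart of `M` at `x`. -/
noncomputable def extDerivOneForm (α : (x : M) → TangentSpace 𝓘(𝕜, E) x →L[𝕜] 𝕜) (x : M) :
    TangentSpace 𝓘(𝕜, E) x [⋀^Fin 2]→L[𝕜] 𝕜 :=
  ContinuousAlternatingMap.compContinuousLinearMap (M' := E)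
    (extDeriv (fun y => ContinuousAlternatingMap.ofSubsingleton 𝕜 E 𝕜 (0 : Fin 1)
      (oneFormInChart α (chartAt E x) y)) (chartAt E x x))
    (mfderiv 𝓘(𝕜, E) 𝓘(𝕜, E) (chartAt E x) x)

end OneForms

/-- A structure of conic symplectic manifold on `M`: a `1`-form `ω` of class `C^∞` (a section of the
cotangent bundle) whose exterior derivative `dω` is a symplectic (closed and non-degenerate)
`2`-form.  Closedness is automatic for an exact form. -/
structure ConicSymplecticStructure (𝕜 : Type*) [RCLike 𝕜] (E : Type*) [NormedAddCommGroup E]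
    [NormedSpace 𝕜 E] (M : Type*) [TopologicalSpace M] [ChartedSpace E M]
    [IsManifold 𝓘(𝕜, E) ∞ M] where
  /-- the `1`-form -/
  form : (x : M) → TangentSpace 𝓘(𝕜, E) x →L[𝕜] 𝕜
  contMDiff_form : ContMDiff 𝓘(𝕜, E) (𝓘(𝕜, E).prod 𝓘(𝕜, E →L[𝕜] 𝕜)) ∞
    (fun x : M => (⟨x, form x⟩ : CotangentBundle 𝕜 E M))
  nondegenerate : ∀ (x : M) (v : TangentSpace 𝓘(𝕜, E) x),
    (∀ w : TangentSpace 𝓘(𝕜, E) x, extDerivOneForm form x ![v, w] = 0) → v = 0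

namespace ConicSymplecticStructure

variable {𝕜 : Type*} [RCLike 𝕜] {E : Type*} [NormedAddCommGroup E] [NormedSpace 𝕜 E]
  {M : Type*} [TopologicalSpace M] [ChartedSpace E M] [IsManifold 𝓘(𝕜, E) ∞ M]

/-- The symplectic form `σ = dω`. -/
noncomputable def sympl (S : ConicSymplecticStructure 𝕜 E M) (x : M)
    (v w : TangentSpace 𝓘(𝕜, E) x) : 𝕜 :=
  extDerivOneForm S.form x ![v, w]

theorem exists_euler [FiniteDimensional 𝕜 E] (S : ConicSymplecticStructure 𝕜 E M) (x : M) :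
    ∃ v : TangentSpace 𝓘(𝕜, E) x, ∀ w, S.sympl x v w = S.form x w := by
  have : FiniteDimensional 𝕜 (TangentSpace 𝓘(𝕜, E) x) := inferInstanceAs (FiniteDimensional 𝕜 E)
  let σ := (extDerivOneForm S.form x).toAlternatingMap
  let B : TangentSpace 𝓘(𝕜, E) x →ₗ[𝕜] Module.Dual 𝕜 (TangentSpace 𝓘(𝕜, E) x) :=
    (LinearMap.mk₂ 𝕜 (fun v w => σ ![v, w])
      (fun v v' w => σ.map_vecCons_add ![w] v v')
      (fun c v w => σ.map_vecCons_smul ![w] c v)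
      (fun v w w' => by
        have h (t) : Function.update ![v, 0] 1 t = ![v, t] := by ext i; fin_cases i <;> rfl
        have := σ.map_update_add ![v, 0] 1 w w'
        rwa [h, h, h] at this)
      (fun c v w => by
        have h (t) : Function.update ![v, 0] 1 t = ![v, t] := by ext i; fin_cases i <;> rfl
        have := σ.map_update_smul ![v, 0] 1 c w
        rwa [h, h] at this))
  have hinj : Function.Injective B := by
    rw [injective_iff_map_eq_zero]
    intro v hv
    exact S.nondegenerate x v (fun w => LinearMap.congr_fun hv w)
  have hsurj : Function.Surjective B :=
    (LinearMap.injective_iff_surjective_of_finrank_eq_finrank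
      (Subspace.dual_finrank_eq (K := 𝕜) (V := TangentSpace 𝓘(𝕜, E) x)).symm).1 hinj
  obtain ⟨v, hv⟩ := hsurj (S.form x : TangentSpace 𝓘(𝕜, E) x →ₗ[𝕜] 𝕜)
  exact ⟨v, fun w => LinearMap.congr_fun hv w⟩

/-- The Euler vector field `θ` of a conic symplectic manifold, determined by `σ(θ, ·) = ω`.  On a
cotangent bundle it is the infinitesimal generator `∑ ξᵢ ∂/∂ξᵢ` of the dilations of the fibres. -/
noncomputable def euler [FiniteDimensional 𝕜 E] (S : ConicSymplecticStructure 𝕜 E M) (x : M) :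
    TangentSpace 𝓘(𝕜, E) x :=
  (S.exists_euler x).choose

theorem sympl_euler [FiniteDimensional 𝕜 E] (S : ConicSymplecticStructure 𝕜 E M) (x : M)
    (w : TangentSpace 𝓘(𝕜, E) x) : S.sympl x (S.euler x) w = S.form x w :=
  (S.exists_euler x).choose_spec w

end ConicSymplecticStructure

/-- A foliation of `M` of class `C^∞` with leaves of dimension `p` and codimension `q`, given by a
foliated atlas: charts of the manifold `M` with values in `𝕜^p × 𝕜^q` that cover `M` and whose
changes of charts are locally of the form `(a, b) ↦ (g (a, b), h b)`. -/
structure Foliation (𝕜 : Type*) [RCLike 𝕜] (E : Type*) [NormedAddCommGroup E] [NormedSpace 𝕜 E]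
    (M : Type*) [TopologicalSpace M] [ChartedSpace E M] (p q : ℕ) where
  /-- the foliated charts -/
  charts : Set (OpenPartialHomeomorph M ((Fin p → 𝕜) × (Fin q → 𝕜)))
  contMDiffOn_chart : ∀ e ∈ charts,
    ContMDiffOn 𝓘(𝕜, E) 𝓘(𝕜, (Fin p → 𝕜) × (Fin q → 𝕜)) ∞ e e.source
  contMDiffOn_chart_symm : ∀ e ∈ charts,
    ContMDiffOn 𝓘(𝕜, (Fin p → 𝕜) × (Fin q → 𝕜)) 𝓘(𝕜, E) ∞ e.symm e.target
  cover : ∀ x : M, ∃ e ∈ charts, x ∈ e.source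
  compatible : ∀ e ∈ charts, ∀ e' ∈ charts, ∀ x ∈ e.source ∩ e'.source, ∃ U ∈ 𝓝 x,
    ∀ y ∈ U, ∀ z ∈ U, (e y).2 = (e z).2 → (e' y).2 = (e' z).2

namespace Foliation

variable {𝕜 : Type*} [RCLike 𝕜] {E : Type*} [NormedAddCommGroup E] [NormedSpace 𝕜 E]
  {M : Type*} [TopologicalSpace M] [ChartedSpace E M] {p q : ℕ}

/-- `F.SamePlaque U y z`: the points `y` and `z` of the open set `U` lie on a common plaque of the
foliation induced on `U`, i.e. on the same connected component of a set `{b = constant}` in the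
domain of a foliated chart `(a, b)` restricted to `U`. -/
def SamePlaque (F : Foliation 𝕜 E M p q) (U : Set M) (y z : M) : Prop :=
  ∃ e ∈ F.charts, z ∈ connectedComponentIn {t ∈ U ∩ e.source | (e t).2 = (e y).2} y

/-- The leaf through `x ∈ U` of the foliation induced on the open set `U`: all the points that are
joined to `x` by a chain of plaques.  For `U = univ` these are the leaves of the foliation. -/
def leafIn (F : Foliation 𝕜 E M p q) (U : Set M) (x : M) : Set M :=
  {y | Relation.ReflTransGen (F.SamePlaque U) x y}

/-- The tangent space at `x` of the leaf through `x`: in a foliated chart `(a, b)` it is the kernel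
of `db`.  All the foliated charts at `x` give the same kernel, so we may take the intersection. -/
noncomputable def tangent (F : Foliation 𝕜 E M p q) (x : M) :
    Submodule 𝕜 (TangentSpace 𝓘(𝕜, E) x) :=
  ⨅ e ∈ F.charts, ⨅ (_ : x ∈ e.source),
    LinearMap.ker (mfderiv 𝓘(𝕜, E) 𝓘(𝕜, Fin q → 𝕜) (fun y => (e y).2) x :
      TangentSpace 𝓘(𝕜, E) x →ₗ[𝕜] TangentSpace 𝓘(𝕜, Fin q → 𝕜) ((e x).2))

/-- The leaves are lagrangian: the tangent space of the leaf at each point is equal to its own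
orthogonal for the symplectic form. -/
def IsLagrangian [IsManifold 𝓘(𝕜, E) ∞ M] (F : Foliation 𝕜 E M p q)
    (S : ConicSymplecticStructure 𝕜 E M) : Prop :=
  ∀ (x : M) (v : TangentSpace 𝓘(𝕜, E) x),
    v ∈ F.tangent x ↔ ∀ w ∈ F.tangent x, S.sympl x v w = 0

/-- The leaves are conic: the Euler vector field, which generates the (local) conic action, is
tangent to the leaves. -/
def IsConic [FiniteDimensional 𝕜 E] [IsManifold 𝓘(𝕜, E) ∞ M] (F : Foliation 𝕜 E M p q)
    (S : ConicSymplecticStructure 𝕜 E M) : Prop :=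
  ∀ x : M, S.euler x ∈ F.tangent x

end Foliation

/-- `φ`, defined on an open subset of `M`, is a homogeneous symplectic map (isomorphism of conic
symplectic manifolds) onto an open subset of `T*X`: it is a diffeomorphism (biholomorphic if
`𝕜 = ℂ`) and it pulls back the canonical `1`-form of `T*X` to the `1`-form of `M`. -/
structure IsHomogeneousSymplectic {𝕜 : Type*} [RCLike 𝕜]
    {E : Type*} [NormedAddCommGroup E] [NormedSpace 𝕜 E]
    {M : Type*} [TopologicalSpace M] [ChartedSpace E M] [IsManifold 𝓘(𝕜, E) ∞ M]
    {V : Type*} [NormedAddCommGroup V] [NormedSpace 𝕜 V]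
    {X : Type*} [TopologicalSpace X] [ChartedSpace V X] [IsManifold 𝓘(𝕜, V) ∞ X]
    (S : ConicSymplecticStructure 𝕜 E M)
    (φ : OpenPartialHomeomorph M (CotangentBundle 𝕜 V X)) : Prop where
  contMDiffOn : ContMDiffOn 𝓘(𝕜, E) (𝓘(𝕜, V).prod 𝓘(𝕜, V →L[𝕜] 𝕜)) ∞ φ φ.source
  contMDiffOn_symm : ContMDiffOn (𝓘(𝕜, V).prod 𝓘(𝕜, V →L[𝕜] 𝕜)) 𝓘(𝕜, E) ∞ φ.symm φ.target
  pullback_canonicalForm : ∀ x ∈ φ.source, ∀ v : TangentSpace 𝓘(𝕜, E) x,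
    CotangentBundle.canonicalForm (φ x)
      (mfderiv 𝓘(𝕜, E) (𝓘(𝕜, V).prod 𝓘(𝕜, V →L[𝕜] 𝕜)) φ x v) = S.form x v

/-! Since the Euler field θ is tangent to the leaves and these are lagrangian, ω = σ(θ, ·) vanishes
on their tangent spaces (`IsConic.form_eq_zero`). In a foliated chart (a, b) this means that ω kills
ker db, so ω = ξ ∘ db with ξ smooth and valued in the dual of 𝕜^q
(`exists_oneFormInChart_eq_comp_fderiv`). The map sought is φ = (b, ξ), with X = 𝕜^q: the Liouville
form pulls back to ξ ∘ db = ω by construction.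

It remains to see that (b, ξ) is a local coordinate system. As dω = ∑ dξᵢ ∧ dbᵢ, a vector killed by
db and dξ lies in the kernel of dω, so the derivative of (b, ξ) is injective. The lagrangian
condition gives q ≤ p, hence 2q ≤ p + q = dim M, and injectivity becomes bijectivity
(`exists_hasFDerivAt_equiv_prodMk`). The inverse function theorem then applies.

For the leaves, U is shrunk so that φ(U) is a ball in the coordinates (b, ξ). Its slices b =
constant are convex, hence connected, so each level set of b in U is a single plaque and is the
whole leaf of the foliation induced on U. -/

/-- Inverse function theorem: near a point where its derivative is invertible, a smooth map is a
diffeomorphism onto a ball. -/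
theorem ContDiffOn.exists_openPartialHomeomorph_ball {𝕜 : Type*} [RCLike 𝕜]
    {E : Type*} [NormedAddCommGroup E] [NormedSpace 𝕜 E] [CompleteSpace E]
    {G : Type*} [NormedAddCommGroup G] [NormedSpace 𝕜 G]
    {f : E → G} {s : Set E} (hs : IsOpen s) {a : E} (ha : a ∈ s) (hf : ContDiffOn 𝕜 ∞ f s)
    {f' : E ≃L[𝕜] G} (hf' : HasFDerivAt f (f' : E →L[𝕜] G) a) :
    ∃ ψ : OpenPartialHomeomorph E G, (∀ y, ψ y = f y) ∧ a ∈ ψ.source ∧ ψ.source ⊆ s ∧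
      ContDiffOn 𝕜 ∞ ψ.symm ψ.target ∧ ∃ r, ψ.target = Metric.ball (f a) r := by
  have hfa := hf.contDiffAt (hs.mem_nhds ha)
  let ψ₀ := hfa.toOpenPartialHomeomorph f hf' (by simp)
  have hcont : ContinuousOn (fderiv 𝕜 f) s :=
    hf.continuousOn_fderiv_of_isOpen hs (by simp)
  -- Invertibility of the derivative is an open condition; keeping it on the whole source makes the
  -- inverse smooth on the whole target, not only at `f a`.
  have hinv : {y | ∃ e : E ≃L[𝕜] G, (e : E →L[𝕜] G) = fderiv 𝕜 f y} ∈ 𝓝 a := by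
    have := f'.nhds
    rw [← hf'.fderiv] at this
    exact (hcont.continuousAt (hs.mem_nhds ha)).preimage_mem_nhds this
  obtain ⟨t, hts, hto, hat⟩ := mem_nhds_iff.1 (Filter.inter_mem (hs.mem_nhds ha) hinv)
  let ψ₁ := ψ₀.restrOpen t hto
  have ha₁ : a ∈ ψ₁.source := ⟨hfa.mem_toOpenPartialHomeomorph_source hf' (by simp), hat⟩
  obtain ⟨r, hr, hball⟩ :=
    Metric.isOpen_iff.1 ψ₁.open_target (f a) (ψ₁.map_source ha₁)
  -- The restriction is made on the target side, so that the target, rather than the source, is a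
  -- ball.
  let ψ := (ψ₁.symm.restrOpen _ (Metric.isOpen_ball (x := f a) (ε := r))).symm
  have hsrc : ψ.source ⊆ ψ₁.source := by
    intro y hy
    simp only [ψ, OpenPartialHomeomorph.symm_source] at hy
    have := (ψ₁.symm.restrOpen _ (Metric.isOpen_ball (x := f a) (ε := r))).map_target hy
    have h2 := (ψ₁.symm.restrOpen _ (Metric.isOpen_ball (x := f a) (ε := r))).right_inv hy
    rw [← h2]
    exact ψ₁.map_target this.1
  have htgt : ψ.target = Metric.ball (f a) r := by
    change ψ₁.target ∩ Metric.ball (f a) r = _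
    exact inter_eq_right.2 hball
  refine ⟨ψ, fun y => rfl, ?_, fun y hy => (hts (hsrc hy).2).1, ?_, r, htgt⟩
  · have h : f a ∈ ψ.target := htgt ▸ Metric.mem_ball_self hr
    have := ψ.map_target h
    rwa [show ψ.symm (f a) = a from ψ₁.left_inv ha₁] at this
  · intro g hg
    have hy := hts (hsrc (ψ.map_target hg)).2
    obtain ⟨e, he⟩ := hy.2
    have hd := hf.contDiffAt (hs.mem_nhds hy.1)
    refine (ψ.contDiffAt_symm (f₀' := e) hg ?_ hd).contDiffWithinAt
    rw [he]
    exact (hd.differentiableAt (by simp)).hasFDerivAt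

/-! ### Leaves as level sets of the transverse coordinate -/

namespace Foliation

variable {𝕜 : Type*} [RCLike 𝕜] {E : Type*} [NormedAddCommGroup E] [NormedSpace 𝕜 E]
  {M : Type*} [TopologicalSpace M] [ChartedSpace E M] {p q : ℕ}

/-- The plaque may come from another foliated chart, but by compatibility the transverse coordinate
of `e` is locally constant along it, hence constant by connectedness. -/
theorem SamePlaque.mem_and_eq {F : Foliation 𝕜 E M p q} {U : Set M} {y z : M}
    (h : F.SamePlaque U y z) {e : OpenPartialHomeomorph M ((Fin p → 𝕜) × (Fin q → 𝕜))}
    (he : e ∈ F.charts) (hU : U ⊆ e.source) : z ∈ U ∧ (e z).2 = (e y).2 := by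
  obtain ⟨e', he', hz⟩ := h
  set s := {t ∈ U ∩ e'.source | (e' t).2 = (e' y).2} with hs
  have hsub := connectedComponentIn_subset s y
  have hy : y ∈ s := by
    by_contra hy
    rw [connectedComponentIn_eq_empty hy] at hz
    exact hz
  refine ⟨(hsub hz).1.1, ?_⟩
  have : PreconnectedSpace (connectedComponentIn s y) :=
    Subtype.preconnectedSpace isPreconnected_connectedComponentIn
  have hlc : IsLocallyConstant (fun t : connectedComponentIn s y => (e t.1).2) := by
    rw [IsLocallyConstant.iff_eventually_eq]
    intro t
    have ht := hsub t.2
    obtain ⟨N, hN, hcomp⟩ := F.compatible e' he' e he t.1 ⟨ht.1.2, hU ht.1.1⟩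
    filter_upwards [continuous_subtype_val.continuousAt.preimage_mem_nhds hN] with t' ht'
    exact hcomp t' ht' t.1 (mem_of_mem_nhds hN) ((hsub t'.2).2.trans ht.2.symm)
  exact hlc.apply_eq_of_preconnectedSpace ⟨z, hz⟩ ⟨y, mem_connectedComponentIn hy⟩

/-- No chain of plaques leaves a level set, and a connected level set is itself one plaque, so
chains of length one suffice. -/
theorem leafIn_eq (F : Foliation 𝕜 E M p q) {U : Set M}
    {e : OpenPartialHomeomorph M ((Fin p → 𝕜) × (Fin q → 𝕜))}
    (he : e ∈ F.charts) (hU : U ⊆ e.source) {x : M} (hx : x ∈ U)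
    (hconn : IsPreconnected {t ∈ U | (e t).2 = (e x).2}) :
    F.leafIn U x = {t ∈ U | (e t).2 = (e x).2} := by
  ext z
  constructor
  · intro hz
    induction hz with
    | refl => exact ⟨hx, rfl⟩
    | tail _ h ih =>
      obtain ⟨h₁, h₂⟩ := h.mem_and_eq he hU
      exact ⟨h₁, h₂.trans ih.2⟩
  · intro hz
    refine Relation.ReflTransGen.single ⟨e, he, ?_⟩
    have : {t ∈ U ∩ e.source | (e t).2 = (e x).2} = {t ∈ U | (e t).2 = (e x).2} := by
      rw [inter_eq_left.2 hU]
    rw [this]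
    exact hconn.subset_connectedComponentIn (x := x) ⟨hx, rfl⟩ subset_rfl hz

end Foliation

/-! ### Exterior derivative of ξ ∘ db and its non-degeneracy -/

section Calculus

variable {𝕜 : Type*} [RCLike 𝕜] {E : Type*} [NormedAddCommGroup E] [NormedSpace 𝕜 E]

/-- The exterior derivative of a `1`-form of the shape `ξ ∘ db = ∑ ξᵢ dbᵢ` is `∑ dξᵢ ∧ dbᵢ`. -/
theorem extDeriv_comp_fderiv {V : Type*} [NormedAddCommGroup V] [NormedSpace 𝕜 V]
    {A : E → E →L[𝕜] 𝕜} {b : E → V} {ξ : E → V →L[𝕜] 𝕜} {a : E}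
    (hb : ContDiffAt 𝕜 ∞ b a) (hξ : DifferentiableAt 𝕜 ξ a)
    (hA : A =ᶠ[𝓝 a] fun y => (ξ y).comp (fderiv 𝕜 b y)) (v w : E) :
    extDeriv (fun y => ContinuousAlternatingMap.ofSubsingleton 𝕜 E 𝕜 (0 : Fin 1) (A y)) a ![v, w] =
      fderiv 𝕜 ξ a v (fderiv 𝕜 b a w) - fderiv 𝕜 ξ a w (fderiv 𝕜 b a v) := by
  have hdb : DifferentiableAt 𝕜 (fderiv 𝕜 b) a :=
    (hb.fderiv_right (m := ∞) (by simp)).differentiableAt (by simp)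
  -- By symmetry of the second derivative of `b`, the term ξ(d²b) disappears on antisymmetrizing.
  have hsymm : fderiv 𝕜 (fderiv 𝕜 b) a v w = fderiv 𝕜 (fderiv 𝕜 b) a w v :=
    hb.isSymmSndFDerivAt (by
      rw [minSmoothness_of_isRCLikeNormedField]; exact WithTop.coe_le_coe.2 le_top) v w
  have hdiff : DifferentiableAt 𝕜 A a := (hξ.clm_comp hdb).congr_of_eventuallyEq hA
  have key (s t : E) : fderiv 𝕜 (fun y => A y s) a t =
      fderiv 𝕜 ξ a t (fderiv 𝕜 b a s) + ξ a (fderiv 𝕜 (fderiv 𝕜 b) a t s) := by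
    have h1 : (fun y => A y s) =ᶠ[𝓝 a] fun y => ξ y (fderiv 𝕜 b y s) := by
      filter_upwards [hA] with y hy
      rw [hy]; rfl
    rw [h1.fderiv_eq, fderiv_clm_apply hξ (hdb.clm_apply (differentiableAt_const s))]
    rw [fderiv_clm_apply hdb (differentiableAt_const s)]
    simp [add_comm]
  have hdiff' : DifferentiableAt 𝕜
      (fun y => ContinuousAlternatingMap.ofSubsingleton 𝕜 E 𝕜 (0 : Fin 1) (A y)) a :=
    (ContinuousAlternatingMap.ofSubsingletonLIE (𝕜 := 𝕜) (E := E) (F := 𝕜)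
      (0 : Fin 1)).differentiableAt.comp a hdiff
  rw [extDeriv_apply hdiff', Fin.sum_univ_two]
  have e0 : ∀ y, ContinuousAlternatingMap.ofSubsingleton 𝕜 E 𝕜 (0 : Fin 1) (A y)
      ((0 : Fin 2).removeNth ![v, w]) = A y w := fun y => rfl
  have e1 : ∀ y, ContinuousAlternatingMap.ofSubsingleton 𝕜 E 𝕜 (0 : Fin 1) (A y)
      ((1 : Fin 2).removeNth ![v, w]) = A y v := fun y => rfl
  simp only [e0, e1]
  simp [key, hsymm]
  ring

/-- If `d(ξ ∘ db)` is non-degenerate at `a` and `2 dim V ≤ dim E`, then the derivative of `(b, ξ)`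
at `a` is invertible. -/
theorem exists_hasFDerivAt_equiv_prodMk [FiniteDimensional 𝕜 E]
    {V : Type*} [NormedAddCommGroup V] [NormedSpace 𝕜 V] [FiniteDimensional 𝕜 V]
    (hdim : 2 * Module.finrank 𝕜 V ≤ Module.finrank 𝕜 E)
    {A : E → E →L[𝕜] 𝕜} {b : E → V} {ξ : E → V →L[𝕜] 𝕜} {a : E}
    (hb : ContDiffAt 𝕜 ∞ b a) (hξ : DifferentiableAt 𝕜 ξ a)
    (hA : A =ᶠ[𝓝 a] fun y => (ξ y).comp (fderiv 𝕜 b y))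
    (hnd : ∀ v, (∀ w, extDeriv
      (fun y => ContinuousAlternatingMap.ofSubsingleton 𝕜 E 𝕜 (0 : Fin 1) (A y)) a ![v, w] = 0) →
      v = 0) :
    ∃ f' : E ≃L[𝕜] V × (V →L[𝕜] 𝕜),
      HasFDerivAt (fun y => (b y, ξ y)) (f' : E →L[𝕜] V × (V →L[𝕜] 𝕜)) a := by
  let D : E →L[𝕜] V × (V →L[𝕜] 𝕜) := (fderiv 𝕜 b a).prod (fderiv 𝕜 ξ a)
  have hD : HasFDerivAt (fun y => (b y, ξ y)) D a :=
    (hb.differentiableAt (by simp)).hasFDerivAt.prodMk hξ.hasFDerivAt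
  have hinj : Function.Injective D := by
    rw [injective_iff_map_eq_zero]
    intro v hv
    have h1 : fderiv 𝕜 b a v = 0 := congrArg Prod.fst hv
    have h2 : fderiv 𝕜 ξ a v = 0 := congrArg Prod.snd hv
    refine hnd v fun w => ?_
    rw [extDeriv_comp_fderiv hb hξ hA, h1, h2]
    simp
  have hdual : Module.finrank 𝕜 (V →L[𝕜] 𝕜) = Module.finrank 𝕜 V := by
    rw [← LinearEquiv.finrank_eq (LinearMap.toContinuousLinearMap (𝕜 := 𝕜) (E := V) (F' := 𝕜))]
    exact Subspace.dual_finrank_eq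
  -- Injectivity of `D` gives one inequality and `hdim` the other.
  have hrk : Module.finrank 𝕜 E = Module.finrank 𝕜 (V × (V →L[𝕜] 𝕜)) := by
    refine le_antisymm (LinearMap.finrank_le_finrank_of_injective (f := D.toLinearMap) hinj) ?_
    rwa [Module.finrank_prod, hdual, ← two_mul]
  let f' := (LinearEquiv.ofInjectiveOfFinrankEq (D : E →ₗ[𝕜] V × (V →L[𝕜] 𝕜)) hinj
    hrk).toContinuousLinearEquiv
  refine ⟨f', ?_⟩
  have : (f' : E →L[𝕜] V × (V →L[𝕜] 𝕜)) = D := by ext1 v; rfl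
  rwa [this]

end Calculus

/-! ### The cotangent bundle of a vector space -/

section Trivialization
variable {𝕜 : Type*} [RCLike 𝕜] {V : Type*} [NormedAddCommGroup V] [NormedSpace 𝕜 V]

/-- All tangent coordinate changes on a vector space are the identity. This is what allows maps into
T*V to be handled as pairs in V × V*. -/
theorem CotangentBundle.trivializationAt_apply (a : V) (ξ : CotangentBundle 𝕜 V V) :
    trivializationAt (V →L[𝕜] 𝕜)
      (fun x : V => TangentSpace 𝓘(𝕜, V) x →L[𝕜] Trivial V 𝕜 x) a ξ = (ξ.1, ξ.2) := by
  rw [hom_trivializationAt_apply]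
  congr 1
  ext v
  simp [ContinuousLinearMap.inCoordinates]
  rfl

end Trivialization

/-! ### Tangent spaces of the leaves -/

namespace Foliation

variable {𝕜 : Type*} [RCLike 𝕜] {E : Type*} [NormedAddCommGroup E] [NormedSpace 𝕜 E]
  {M : Type*} [TopologicalSpace M] [ChartedSpace E M] {p q : ℕ}

theorem mdifferentiable_chart (F : Foliation 𝕜 E M p q)
    {e : OpenPartialHomeomorph M ((Fin p → 𝕜) × (Fin q → 𝕜))} (he : e ∈ F.charts) :
    e.MDifferentiable 𝓘(𝕜, E) 𝓘(𝕜, (Fin p → 𝕜) × (Fin q → 𝕜)) :=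
  ⟨(F.contMDiffOn_chart e he).mdifferentiableOn (by simp),
    (F.contMDiffOn_chart_symm e he).mdifferentiableOn (by simp)⟩

theorem hasMFDerivAt_chart_snd (F : Foliation 𝕜 E M p q)
    {e : OpenPartialHomeomorph M ((Fin p → 𝕜) × (Fin q → 𝕜))} (he : e ∈ F.charts) {x : M}
    (hx : x ∈ e.source) :
    HasMFDerivAt 𝓘(𝕜, E) 𝓘(𝕜, Fin q → 𝕜) (fun y => (e y).2) x
      ((ContinuousLinearMap.snd 𝕜 (Fin p → 𝕜) (Fin q → 𝕜)).comp
        (mfderiv 𝓘(𝕜, E) 𝓘(𝕜, (Fin p → 𝕜) × (Fin q → 𝕜)) e x)) :=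
  HasMFDerivAt.comp x (hasFDerivAt_snd (p := e x)).hasMFDerivAt
    ((F.mdifferentiable_chart he).mdifferentiableAt hx).hasMFDerivAt

/-- The tangent space of the leaf through `x` is the kernel of `db`, for any foliated chart
`(a, b)` at `x`. -/
theorem mem_tangent_iff (F : Foliation 𝕜 E M p q)
    {e : OpenPartialHomeomorph M ((Fin p → 𝕜) × (Fin q → 𝕜))} (he : e ∈ F.charts) {x : M}
    (hx : x ∈ e.source) (v : TangentSpace 𝓘(𝕜, E) x) :
    v ∈ F.tangent x ↔
      (mfderiv 𝓘(𝕜, E) 𝓘(𝕜, (Fin p → 𝕜) × (Fin q → 𝕜)) e x v : (Fin p → 𝕜) × (Fin q → 𝕜)).2 = 0 := by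
  simp only [tangent, Submodule.mem_iInf, LinearMap.mem_ker]
  constructor
  · intro h
    have := h e he hx
    rw [(F.hasMFDerivAt_chart_snd he hx).mfderiv] at this
    exact this
  · intro h0 e' he' hx'
    obtain ⟨N, hN, hcomp⟩ := F.compatible e he e' he' x ⟨hx, hx'⟩
    -- `h` is the transverse change of coordinates, read on the slice a = a(x). Compatibility gives
    -- b' = h ∘ b near `x`, so ker db is contained in ker db'.
    let h : (Fin q → 𝕜) → (Fin q → 𝕜) := fun s => (e' (e.symm ((e x).1, s))).2
    have hj : ContinuousAt (fun y => ((e x).1, (e y).2)) x :=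
      continuousAt_const.prodMk (continuousAt_snd.comp (e.continuousAt hx))
    have hsymm : ContinuousAt (fun y => e.symm ((e x).1, (e y).2)) x :=
      ContinuousAt.comp (g := e.symm) (e.continuousAt_symm (e.map_source hx)) hj
    have heq : (fun y => (e' y).2) =ᶠ[𝓝 x] h ∘ fun y => (e y).2 := by
      have hN' : N ∈ 𝓝 (e.symm (e x)) := by rwa [e.left_inv hx]
      have ht : ∀ᶠ y in 𝓝 x, ((e x).1, (e y).2) ∈ e.target :=
        hj.preimage_mem_nhds (e.open_target.mem_nhds (e.map_source hx))
      filter_upwards [hN, hsymm.preimage_mem_nhds hN', ht] with y hy hy' hyt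
      refine hcomp y hy _ hy' ?_
      rw [e.right_inv hyt]
    have hj' : MDifferentiableAt 𝓘(𝕜, Fin q → 𝕜) 𝓘(𝕜, (Fin p → 𝕜) × (Fin q → 𝕜))
        (fun s : Fin q → 𝕜 => ((e x).1, s)) (e x).2 :=
      ((differentiableAt_const (e x).1).prodMk differentiableAt_id).mdifferentiableAt
    have hs : MDifferentiableAt 𝓘(𝕜, Fin q → 𝕜) 𝓘(𝕜, E) (fun s => e.symm ((e x).1, s)) (e x).2 :=
      MDifferentiableAt.comp (e x).2 (g := e.symm)
        ((F.mdifferentiable_chart he).mdifferentiableAt_symm (e.map_source hx)) hj'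
    have hh : MDifferentiableAt 𝓘(𝕜, Fin q → 𝕜) 𝓘(𝕜, Fin q → 𝕜) h (e x).2 :=
      MDifferentiableAt.comp_of_eq (g := fun y => (e' y).2) (e x).2 (y := x)
        (F.hasMFDerivAt_chart_snd he' hx').mdifferentiableAt hs (e.left_inv hx)
    have hd := F.hasMFDerivAt_chart_snd he hx
    rw [heq.mfderiv_eq, (HasMFDerivAt.comp x hh.hasMFDerivAt hd).mfderiv]
    exact (congrArg (mfderiv 𝓘(𝕜, Fin q → 𝕜) 𝓘(𝕜, Fin q → 𝕜) h (e x).2) h0).trans (map_zero _)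

end Foliation

/-! ### The 1-form in coordinates, and dimension counts -/

section
variable {𝕜 : Type*} [RCLike 𝕜] {E : Type*} [NormedAddCommGroup E] [NormedSpace 𝕜 E]
  {M : Type*} [TopologicalSpace M] [ChartedSpace E M] [IsManifold 𝓘(𝕜, E) ∞ M] {p q : ℕ}

theorem mdifferentiable_chartAt (x₀ : M) :
    (chartAt E x₀).MDifferentiable 𝓘(𝕜, E) 𝓘(𝕜, E) :=
  have : IsManifold 𝓘(𝕜, E) 1 M := .of_le (n := ∞) (by simp)
  mdifferentiable_chart x₀

/-- Over the chart domain, the inverse of the tangent trivialization is the derivative of the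
inverse chart, so the local expression of the form is the fibre component of the smooth section in
the bundle trivialization at `x₀`. -/
theorem ConicSymplecticStructure.contDiffOn_oneFormInChart (S : ConicSymplecticStructure 𝕜 E M)
    (x₀ : M) :
    ContDiffOn 𝕜 ∞ (oneFormInChart S.form (chartAt E x₀)) (chartAt E x₀).target := by
  let c := chartAt E x₀
  let t := trivializationAt (E →L[𝕜] 𝕜)
    (fun x : M => TangentSpace 𝓘(𝕜, E) x →L[𝕜] Trivial M 𝕜 x) x₀
  have ht : ContMDiffOn (𝓘(𝕜, E).prod 𝓘(𝕜, E →L[𝕜] 𝕜)) (𝓘(𝕜, E).prod 𝓘(𝕜, E →L[𝕜] 𝕜)) ∞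
      t t.source := t.contMDiffOn
  have h1 : ContMDiffOn 𝓘(𝕜, E) (𝓘(𝕜, E).prod 𝓘(𝕜, E →L[𝕜] 𝕜)) ∞
      (fun y : E => t ⟨c.symm y, S.form (c.symm y)⟩) c.target := by
    refine ht.comp (S.contMDiff_form.comp_contMDiffOn (contMDiffOn_chart_symm (x := x₀))) ?_
    intro y hy
    exact t.mem_source.2 ⟨c.map_target hy, mem_univ _⟩
  have h2 : ContDiffOn 𝕜 ∞
      (fun y : E => (t ⟨c.symm y, S.form (c.symm y)⟩).2) c.target :=
    contMDiffOn_iff_contDiffOn.1 (contMDiff_snd.comp_contMDiffOn h1)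
  refine h2.congr fun y hy => ?_
  have hsrc := c.map_target hy
  have : IsManifold 𝓘(𝕜, E) 1 M := .of_le (n := ∞) (by simp)
  have h3 := TangentBundle.symmL_trivializationAt (I := 𝓘(𝕜, E)) (𝕜 := 𝕜) (x₀ := x₀) hsrc
  simp only [t]
  rw [hom_trivializationAt_apply]
  ext v
  have h4 : mfderivWithin 𝓘(𝕜, E) 𝓘(𝕜, E) (extChartAt 𝓘(𝕜, E) x₀).symm (range 𝓘(𝕜, E))
      (extChartAt 𝓘(𝕜, E) x₀ (c.symm y)) = mfderiv 𝓘(𝕜, E) 𝓘(𝕜, E) c.symm y := by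
    have h5 : chartAt E x₀ ((chartAt E x₀).symm y) = y := c.right_inv hy
    simp only [c, mfld_simps, mfderivWithin_univ]
    rw [h5]
  have h6 := congrArg (fun L => L v) (h3.trans h4)
  simp only [ContinuousLinearMap.inCoordinates, oneFormInChart, ContinuousLinearMap.comp_apply,
    Trivial.fiberBundle_trivializationAt', Trivial.continuousLinearMapAt_trivialization]
  exact congrArg (S.form (c.symm y)) h6.symm

theorem oneFormInChart_mfderiv (α : (x : M) → TangentSpace 𝓘(𝕜, E) x →L[𝕜] 𝕜) (x₀ : M) {x : M}
    (hx : x ∈ (chartAt E x₀).source) (v : TangentSpace 𝓘(𝕜, E) x) :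
    oneFormInChart α (chartAt E x₀) (chartAt E x₀ x)
      (mfderiv 𝓘(𝕜, E) 𝓘(𝕜, E) (chartAt E x₀) x v) = α x v := by
  have h := congrArg (fun L => L v)
    ((mdifferentiable_chartAt (𝕜 := 𝕜) x₀).symm_comp_deriv hx)
  have key : ∀ x', x' = x → ∀ u : E, u = v → α x' u = α x v := by
    rintro x' rfl u rfl; rfl
  exact key _ ((chartAt E x₀).left_inv hx) _ h

namespace Foliation
variable [FiniteDimensional 𝕜 E] {S : ConicSymplecticStructure 𝕜 E M} {F : Foliation 𝕜 E M p q}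

/-- The `1`-form of a conic symplectic manifold vanishes on conic lagrangian leaves. -/
theorem IsConic.form_eq_zero (hconic : F.IsConic S) (hlag : F.IsLagrangian S) {x : M}
    {w : TangentSpace 𝓘(𝕜, E) x} (hw : w ∈ F.tangent x) : S.form x w = 0 := by
  rw [← S.sympl_euler x w]
  exact (hlag x _).1 (hconic x) w hw

omit [IsManifold 𝓘(𝕜, E) ∞ M] [FiniteDimensional 𝕜 E] in
theorem finrank_model_eq {e : OpenPartialHomeomorph M ((Fin p → 𝕜) × (Fin q → 𝕜))}
    (he : e ∈ F.charts) {x : M} (hx : x ∈ e.source) : Module.finrank 𝕜 E = p + q := by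
  have := ((F.mdifferentiable_chart he).mfderiv hx).toLinearEquiv.finrank_eq
  exact this.trans ((Module.finrank_prod (R := 𝕜) (M := Fin p → 𝕜) (M' := Fin q → 𝕜)).trans
    (by simp))

omit [IsManifold 𝓘(𝕜, E) ∞ M] in
theorem finrank_tangent (F : Foliation 𝕜 E M p q) (x : M) :
    Module.finrank 𝕜 (F.tangent x) = p := by
  obtain ⟨e, he, hx⟩ := F.cover x
  let D : TangentSpace 𝓘(𝕜, E) x →ₗ[𝕜] (Fin q → 𝕜) :=
    LinearMap.snd 𝕜 (Fin p → 𝕜) (Fin q → 𝕜) ∘ₗ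
      ((F.mdifferentiable_chart he).mfderiv hx).toLinearEquiv.toLinearMap
  have hker : F.tangent x = LinearMap.ker D := by
    ext v
    exact F.mem_tangent_iff he hx v
  have hsurj : Function.Surjective D :=
    (LinearMap.snd_surjective (R := 𝕜) (M := Fin p → 𝕜) (M₂ := Fin q → 𝕜)).comp
      ((F.mdifferentiable_chart he).mfderiv hx).surjective
  have : FiniteDimensional 𝕜 (TangentSpace 𝓘(𝕜, E) x) := inferInstanceAs (FiniteDimensional 𝕜 E)
  have h1 := LinearMap.finrank_range_add_finrank_ker D
  have h2 : Module.finrank 𝕜 (TangentSpace 𝓘(𝕜, E) x) = p + q := F.finrank_model_eq he hx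
  rw [LinearMap.range_eq_top.2 hsurj, finrank_top, Module.finrank_fin_fun, h2, ← hker] at h1
  omega

/-- The map v ↦ σ(v, ·) restricted to the tangent space of the leaf has that tangent space, of
dimension p, as its kernel. Its rank is therefore (p + q) - p = q, and it takes values in a dual of
dimension p. -/
theorem IsLagrangian.le (hlag : F.IsLagrangian S) (x : M) : q ≤ p := by
  have : FiniteDimensional 𝕜 (TangentSpace 𝓘(𝕜, E) x) := inferInstanceAs (FiniteDimensional 𝕜 E)
  obtain ⟨e, he, hx⟩ := F.cover x
  let σ := (extDerivOneForm S.form x).toAlternatingMap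
  let B : TangentSpace 𝓘(𝕜, E) x →ₗ[𝕜] Module.Dual 𝕜 (F.tangent x) :=
    LinearMap.mk₂ 𝕜 (fun v w => σ ![v, w])
      (fun v v' w => σ.map_vecCons_add ![(w : TangentSpace 𝓘(𝕜, E) x)] v v')
      (fun c v w => σ.map_vecCons_smul ![(w : TangentSpace 𝓘(𝕜, E) x)] c v)
      (fun v w w' => by
        have h (t) : Function.update ![v, 0] 1 t = ![v, t] := by ext i; fin_cases i <;> rfl
        have := σ.map_update_add ![v, 0] 1 (w : TangentSpace 𝓘(𝕜, E) x) w'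
        rwa [h, h, h] at this)
      (fun c v w => by
        have h (t) : Function.update ![v, 0] 1 t = ![v, t] := by ext i; fin_cases i <;> rfl
        have := σ.map_update_smul ![v, 0] 1 c (w : TangentSpace 𝓘(𝕜, E) x)
        rwa [h, h] at this)
  have hker : LinearMap.ker B = F.tangent x := by
    ext v
    rw [LinearMap.mem_ker, hlag x v, LinearMap.ext_iff, Subtype.forall]
    rfl
  have h1 := LinearMap.finrank_range_add_finrank_ker B
  have h2 : Module.finrank 𝕜 (TangentSpace 𝓘(𝕜, E) x) = p + q := F.finrank_model_eq he hx
  have h3 := (LinearMap.range B).finrank_le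
  rw [Subspace.dual_finrank_eq, finrank_tangent] at h3
  rw [hker, finrank_tangent, h2] at h1
  omega

/-- In the coordinates of the manifold, the `1`-form is `ξ ∘ db` where `b` is the transverse
coordinate of a foliated chart. -/
theorem exists_oneFormInChart_eq_comp_fderiv (hconic : F.IsConic S) (hlag : F.IsLagrangian S)
    {e : OpenPartialHomeomorph M ((Fin p → 𝕜) × (Fin q → 𝕜))} (he : e ∈ F.charts) (x₀ : M) :
    ContDiffOn 𝕜 ∞ (fun y => (e ((chartAt E x₀).symm y)).2)
        ((chartAt E x₀).symm.trans e).source ∧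
      ∃ ξ : E → (Fin q → 𝕜) →L[𝕜] 𝕜,
        ContDiffOn 𝕜 ∞ ξ ((chartAt E x₀).symm.trans e).source ∧
        ∀ y ∈ ((chartAt E x₀).symm.trans e).source,
          oneFormInChart S.form (chartAt E x₀) y =
            (ξ y).comp (fderiv 𝕜 (fun y => (e ((chartAt E x₀).symm y)).2) y) := by
  set c := chartAt E x₀
  set T := c.symm.trans e
  have hsm : ContDiffOn 𝕜 ∞ T T.source := by
    refine contMDiffOn_iff_contDiffOn.1 ((F.contMDiffOn_chart e he).comp
      ((_root_.contMDiffOn_chart_symm (x := x₀)).mono fun y hy => hy.1) fun y hy => hy.2)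
  have hsm' : ContDiffOn 𝕜 ∞ T.symm T.target := by
    refine contMDiffOn_iff_contDiffOn.1 ((_root_.contMDiffOn_chart (x := x₀)).comp
      ((F.contMDiffOn_chart_symm e he).mono fun y hy => hy.1) fun y hy => hy.2)
  have hb : ContDiffOn 𝕜 ∞ (fun y => (T y).2) T.source := contDiff_snd.comp_contDiffOn hsm
  -- `R y` inverts the derivative of `T` at `y`; preceded by the inclusion of the second factor it
  -- gives a smooth right inverse of db. Evaluating the form on it defines ξ.
  let R : E → (Fin p → 𝕜) × (Fin q → 𝕜) →L[𝕜] E := fun y => fderiv 𝕜 T.symm (T y)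
  have hR : ContDiffOn 𝕜 ∞ R T.source :=
    (hsm'.fderiv_of_isOpen T.open_target (m := ∞) (by simp)).comp hsm T.mapsTo
  refine ⟨hb, fun y => (oneFormInChart S.form c y).comp ((R y).comp (.inr 𝕜 _ _)), ?_, ?_⟩
  · exact ((S.contDiffOn_oneFormInChart x₀).mono fun y hy => hy.1).clm_comp
      (hR.clm_comp contDiffOn_const)
  · intro y hy
    have hTd : HasFDerivAt T (fderiv 𝕜 T y) y :=
      ((hsm.contDiffAt (T.open_source.mem_nhds hy)).differentiableAt (by simp)).hasFDerivAt
    have hTd' : HasFDerivAt T.symm (R y) (T y) :=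
      ((hsm'.contDiffAt (T.open_target.mem_nhds (T.map_source hy))).differentiableAt
        (by simp)).hasFDerivAt
    have hinv (g) : fderiv 𝕜 T y (R y g) = g := by
      have h1 : HasFDerivAt (T ∘ T.symm) ((fderiv 𝕜 T y).comp (R y)) (T y) :=
        HasFDerivAt.comp (T y) (by rwa [T.left_inv hy]) hTd'
      have h2 : T ∘ T.symm =ᶠ[𝓝 (T y)] id :=
        T.eventually_right_inverse (T.map_source hy)
      exact congrArg (fun L => L g) (h1.unique ((hasFDerivAt_id _).congr_of_eventuallyEq h2))
    have hbd : fderiv 𝕜 (fun y => (T y).2) y = (ContinuousLinearMap.snd 𝕜 _ _).comp (fderiv 𝕜 T y) :=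
      hTd.snd.fderiv
    have hvan (z : E) (hz : (fderiv 𝕜 T y z).2 = 0) : oneFormInChart S.form c y z = 0 := by
      refine hconic.form_eq_zero hlag ((F.mem_tangent_iff he hy.2 _).2 ?_)
      have h1 := HasMFDerivAt.comp y
        ((F.mdifferentiable_chart he).mdifferentiableAt hy.2).hasMFDerivAt
        ((mdifferentiable_chartAt (𝕜 := 𝕜) x₀).mdifferentiableAt_symm hy.1).hasMFDerivAt
      have h2 := hasMFDerivAt_unique h1 hTd.hasMFDerivAt
      have h3 := congrArg (fun L => L z) h2
      exact (congrArg Prod.snd h3).trans hz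
    change oneFormInChart S.form c y = _ ∘SL (fderiv 𝕜 (fun y => (T y).2) y)
    rw [hbd]
    ext w
    -- The difference of `w` and its transverse lift lies in ker db, where the form vanishes.
    have := hvan (w - R y (0, (fderiv 𝕜 T y w).2)) (by rw [map_sub, hinv]; simp)
    rw [map_sub, sub_eq_zero] at this
    exact this

end Foliation
end

/-! ### Adapted coordinates and the homogeneous symplectic map -/

/-- Leaves are carried onto fibres by any chart through which the transverse coordinate of a foliated
chart factors, provided the fibres in the target are preconnected. -/
theorem Foliation.image_leafIn_eq {𝕜 : Type*} [RCLike 𝕜]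
    {E : Type*} [NormedAddCommGroup E] [NormedSpace 𝕜 E]
    {M : Type*} [TopologicalSpace M] [ChartedSpace E M] {p q : ℕ} (F : Foliation 𝕜 E M p q)
    {e : OpenPartialHomeomorph M ((Fin p → 𝕜) × (Fin q → 𝕜))} (he : e ∈ F.charts)
    {Z : Type*} [TopologicalSpace Z] (φ : OpenPartialHomeomorph M Z) (pr : Z → Fin q → 𝕜)
    (hφe : φ.source ⊆ e.source) (hpr : ∀ x ∈ φ.source, pr (φ x) = (e x).2)
    (hpre : ∀ s, IsPreconnected {ζ ∈ φ.target | pr ζ = s}) {x : M} (hx : x ∈ φ.source) :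
    φ '' F.leafIn φ.source x = {ζ ∈ φ.target | pr ζ = pr (φ x)} := by
  have hleaf : {z ∈ φ.source | (e z).2 = (e x).2} = φ.symm '' {ζ ∈ φ.target | pr ζ = (e x).2} := by
    ext z
    constructor
    · intro hz
      exact ⟨φ z, ⟨φ.map_source hz.1, (hpr z hz.1).trans hz.2⟩, φ.left_inv hz.1⟩
    · rintro ⟨ζ, hζ, rfl⟩
      refine ⟨φ.map_target hζ.1, ?_⟩
      rw [← hpr _ (φ.map_target hζ.1), φ.right_inv hζ.1]
      exact hζ.2
  rw [F.leafIn_eq he hφe hx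
    (hleaf ▸ (hpre _).image _ (φ.continuousOn_symm.mono fun ζ hζ => hζ.1)), hleaf, hpr x hx]
  exact φ.image_symm_image_of_subset_target fun ζ hζ => hζ.1

/-- A conic lagrangian foliation has adapted coordinates `(b, ξ)` with values in a ball in which the
`1`-form is `∑ ξᵢ dbᵢ` and the leaves are given by `b = constant`. -/
theorem Foliation.exists_adapted_coordinates {𝕜 : Type*} [RCLike 𝕜]
    {E : Type*} [NormedAddCommGroup E] [NormedSpace 𝕜 E] [FiniteDimensional 𝕜 E]
    {M : Type*} [TopologicalSpace M] [ChartedSpace E M] [IsManifold 𝓘(𝕜, E) ∞ M]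
    {p q : ℕ} {S : ConicSymplecticStructure 𝕜 E M} {F : Foliation 𝕜 E M p q}
    (hlag : F.IsLagrangian S) (hconic : F.IsConic S)
    {e : OpenPartialHomeomorph M ((Fin p → 𝕜) × (Fin q → 𝕜))} (he : e ∈ F.charts) {x₀ : M}
    (hx₀ : x₀ ∈ e.source) :
    ∃ (ξ : E → (Fin q → 𝕜) →L[𝕜] 𝕜)
      (ψ : OpenPartialHomeomorph E ((Fin q → 𝕜) × ((Fin q → 𝕜) →L[𝕜] 𝕜))),
      (∀ y, ψ y = ((e ((chartAt E x₀).symm y)).2, ξ y)) ∧ chartAt E x₀ x₀ ∈ ψ.source ∧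
      ψ.source ⊆ ((chartAt E x₀).symm.trans e).source ∧
      ContDiffOn 𝕜 ∞ (fun y => (e ((chartAt E x₀).symm y)).2) ψ.source ∧
      ContDiffOn 𝕜 ∞ ξ ψ.source ∧ ContDiffOn 𝕜 ∞ ψ.symm ψ.target ∧
      (∃ g r, ψ.target = Metric.ball g r) ∧
      ∀ y ∈ ψ.source, oneFormInChart S.form (chartAt E x₀) y =
        (ξ y).comp (fderiv 𝕜 (fun y => (e ((chartAt E x₀).symm y)).2) y) := by
  have : CompleteSpace E := FiniteDimensional.complete 𝕜 E
  obtain ⟨hb, ξ, hξ, hA⟩ := Foliation.exists_oneFormInChart_eq_comp_fderiv hconic hlag he x₀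
  set c := chartAt E x₀
  set T := c.symm.trans e
  have hc₀ : x₀ ∈ c.source := mem_chart_source E x₀
  have hy₀ : c x₀ ∈ T.source := ⟨c.map_source hc₀, by
    change c.symm (c x₀) ∈ e.source
    rwa [c.left_inv hc₀]⟩
  have hTn : T.source ∈ 𝓝 (c x₀) := T.open_source.mem_nhds hy₀
  have hdim : 2 * Module.finrank 𝕜 (Fin q → 𝕜) ≤ Module.finrank 𝕜 E := by
    rw [F.finrank_model_eq he hx₀, Module.finrank_fin_fun]
    have := hlag.le x₀
    omega
  have hnd : ∀ v, (∀ w, extDeriv (fun y => ContinuousAlternatingMap.ofSubsingleton 𝕜 E 𝕜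
      (0 : Fin 1) (oneFormInChart S.form c y)) (c x₀) ![v, w] = 0) → v = 0 := by
    intro v hv
    obtain ⟨v', hv'⟩ := ((mdifferentiable_chartAt (𝕜 := 𝕜) x₀).mfderiv_surjective hc₀ v)
    have hz : v' = 0 := by
      refine S.nondegenerate x₀ v' fun w => ?_
      have := hv (mfderiv 𝓘(𝕜, E) 𝓘(𝕜, E) c x₀ w)
      rw [← hv'] at this
      refine Eq.trans (congrArg (extDeriv (fun y => ContinuousAlternatingMap.ofSubsingleton 𝕜 E 𝕜
        (0 : Fin 1) (oneFormInChart S.form c y)) (c x₀)) ?_) this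
      ext i
      fin_cases i <;> rfl
    rw [← hv', hz, map_zero]
    rfl
  obtain ⟨f', hf'⟩ := exists_hasFDerivAt_equiv_prodMk hdim (hb.contDiffAt hTn)
    ((hξ.contDiffAt hTn).differentiableAt (by simp))
    (Filter.eventually_of_mem hTn hA) hnd
  obtain ⟨ψ, hψ, hψ₀, hψs, hψsymm, r, hψt⟩ :=
    (hb.prodMk hξ).exists_openPartialHomeomorph_ball T.open_source hy₀ hf'
  exact ⟨ξ, ψ, hψ, hψ₀, hψs, hb.mono hψs, hξ.mono hψs, hψsymm, ⟨_, r, hψt⟩,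
    fun y hy => hA y (hψs hy)⟩

theorem mainTheorem7 {𝕜 : Type u} [RCLike 𝕜]
    {E : Type*} [NormedAddCommGroup E] [NormedSpace 𝕜 E] [FiniteDimensional 𝕜 E]
    {M : Type*} [TopologicalSpace M] [ChartedSpace E M] [IsManifold 𝓘(𝕜, E) ∞ M]
    {p q : ℕ} (S : ConicSymplecticStructure 𝕜 E M) (F : Foliation 𝕜 E M p q)
    (hlag : F.IsLagrangian S) (hconic : F.IsConic S) (x₀ : M) :
    ∃ (X : Type u) (_ : TopologicalSpace X) (_ : T2Space X) (_ : SecondCountableTopology X)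
      (_ : ChartedSpace (Fin q → 𝕜) X) (_ : IsManifold 𝓘(𝕜, Fin q → 𝕜) ∞ X)
      (φ : OpenPartialHomeomorph M (CotangentBundle 𝕜 (Fin q → 𝕜) X)),
      x₀ ∈ φ.source ∧
      IsHomogeneousSymplectic S φ ∧
      ∀ x ∈ φ.source, φ '' (F.leafIn φ.source x) =
        {ξ ∈ φ.target | CotangentBundle.proj ξ = CotangentBundle.proj (φ x)} := by
  obtain ⟨e, he, hx₀⟩ := F.cover x₀
  obtain ⟨ξ, ψ, hψ, hψ₀, hψs, hb, hξ, hψsymm, ⟨g₀, r, hψt⟩, hA⟩ :=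
    Foliation.exists_adapted_coordinates hlag hconic he hx₀
  set c := chartAt E x₀
  let t := trivializationAt ((Fin q → 𝕜) →L[𝕜] 𝕜) (fun x : Fin q → 𝕜 =>
    TangentSpace 𝓘(𝕜, Fin q → 𝕜) x →L[𝕜] Trivial (Fin q → 𝕜) 𝕜 x) 0
  have htapp (ζ : CotangentBundle 𝕜 (Fin q → 𝕜) (Fin q → 𝕜)) : t ζ = (ζ.1, ζ.2) :=
    CotangentBundle.trivializationAt_apply 0 ζ
  -- The trivialization at 0 is global, since the base is a vector space.
  have hts : t.source = univ := eq_univ_of_forall fun _ => ⟨mem_univ _, mem_univ _⟩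
  have htt : t.target = univ := eq_univ_of_forall fun _ => ⟨⟨mem_univ _, mem_univ _⟩, mem_univ _⟩
  have htsymm (g) : t (t.toOpenPartialHomeomorph.symm g) = g :=
    t.toOpenPartialHomeomorph.right_inv (htt ▸ mem_univ g)
  let φ : OpenPartialHomeomorph M (CotangentBundle 𝕜 (Fin q → 𝕜) (Fin q → 𝕜)) :=
    (c.trans ψ).trans t.toOpenPartialHomeomorph.symm
  have hφs : φ.source = (c.trans ψ).source := by
    change (c.trans ψ).source ∩ _ ⁻¹' t.target = _
    rw [htt]; simp
  have hφt : ∀ ζ, ζ ∈ φ.target ↔ t ζ ∈ ψ.target := by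
    intro ζ
    change ζ ∈ t.source ∩ t ⁻¹' (ψ.target ∩ ψ.symm ⁻¹' c.target) ↔ _
    rw [hts]
    exact ⟨fun h => h.2.1, fun h => ⟨mem_univ _, h, (hψs (ψ.map_target h)).1⟩⟩
  have htφ : ∀ x, t (φ x) = ψ (c x) := fun x => htsymm _
  have hφ1 (x) (hx : x ∈ φ.source) : (φ x).1 = (e x).2 := by
    have := (congrArg Prod.fst ((htapp (φ x)).symm.trans ((htφ x).trans (hψ (c x)))))
    rw [hφs] at hx
    simpa [c.left_inv hx.1] using this
  have hφ2 (x) : (φ x).2 = ξ (c x) :=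
    congrArg Prod.snd ((htapp (φ x)).symm.trans ((htφ x).trans (hψ (c x))))
  have hφe : φ.source ⊆ e.source := by
    rw [hφs]
    intro x hx
    have := (hψs hx.2).2
    rwa [← c.left_inv hx.1]
  have hφsm : ContMDiffOn 𝓘(𝕜, E) (𝓘(𝕜, Fin q → 𝕜).prod 𝓘(𝕜, (Fin q → 𝕜) →L[𝕜] 𝕜)) ∞
      φ φ.source := by
    have h1 : ContMDiffOn 𝓘(𝕜, E) (𝓘(𝕜, Fin q → 𝕜).prod 𝓘(𝕜, (Fin q → 𝕜) →L[𝕜] 𝕜)) ∞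
        ψ ψ.source :=
      (hb.contMDiffOn.prodMk hξ.contMDiffOn).congr fun y _ => hψ y
    have h2 : ContMDiffOn (𝓘(𝕜, Fin q → 𝕜).prod 𝓘(𝕜, (Fin q → 𝕜) →L[𝕜] 𝕜))
        (𝓘(𝕜, Fin q → 𝕜).prod 𝓘(𝕜, (Fin q → 𝕜) →L[𝕜] 𝕜)) ∞
        t.toOpenPartialHomeomorph.symm t.target := t.contMDiffOn_symm
    rw [hφs]
    exact h2.comp (h1.comp ((contMDiffOn_chart (x := x₀)).mono fun x hx => hx.1) fun x hx => hx.2)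
      fun x _ => htt ▸ mem_univ _
  refine ⟨Fin q → 𝕜, inferInstance, inferInstance, inferInstance, inferInstance, inferInstance,
    φ, ?_, ⟨?_, ?_, ?_⟩, ?_⟩
  · rw [hφs]
    exact ⟨mem_chart_source E x₀, hψ₀⟩
  · exact hφsm
  · have h1 : ContMDiffOn (𝓘(𝕜, Fin q → 𝕜).prod 𝓘(𝕜, (Fin q → 𝕜) →L[𝕜] 𝕜)) 𝓘(𝕜, E) ∞
        ψ.symm ψ.target := by
      rw [← modelWithCornersSelf_prod, chartedSpaceSelf_prod]
      exact hψsymm.contMDiffOn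
    have h2 : ContMDiffOn (𝓘(𝕜, Fin q → 𝕜).prod 𝓘(𝕜, (Fin q → 𝕜) →L[𝕜] 𝕜))
        (𝓘(𝕜, Fin q → 𝕜).prod 𝓘(𝕜, (Fin q → 𝕜) →L[𝕜] 𝕜)) ∞ t t.source := t.contMDiffOn
    exact (contMDiffOn_chart_symm (x := x₀)).comp
      (h1.comp (h2.mono fun ζ _ => hts ▸ mem_univ ζ) fun ζ hζ => (hφt ζ).1 hζ)
      fun ζ hζ => (hψs (ψ.map_target ((hφt ζ).1 hζ))).1
  · intro x hx v
    have hxc : x ∈ c.source := (hφs ▸ hx : x ∈ (c.trans ψ).source).1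
    have hcx : c x ∈ ψ.source := (hφs ▸ hx : x ∈ (c.trans ψ).source).2
    have hφd := ((hφsm.contMDiffAt (φ.open_source.mem_nhds hx)).mdifferentiableAt
      (by simp)).hasMFDerivAt
    have hpd : MDifferentiableAt (𝓘(𝕜, Fin q → 𝕜).prod 𝓘(𝕜, (Fin q → 𝕜) →L[𝕜] 𝕜))
        𝓘(𝕜, Fin q → 𝕜)
        (CotangentBundle.proj : CotangentBundle 𝕜 (Fin q → 𝕜) (Fin q → 𝕜) → Fin q → 𝕜) (φ x) :=
      (contMDiff_proj (n := 1) (IB := 𝓘(𝕜, Fin q → 𝕜)) (F := (Fin q → 𝕜) →L[𝕜] 𝕜)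
        (fun x : Fin q → 𝕜 => TangentSpace 𝓘(𝕜, Fin q → 𝕜) x →L[𝕜] Trivial (Fin q → 𝕜) 𝕜 x)
        ).mdifferentiableAt (by simp)
    have h1 := HasMFDerivAt.comp x hpd.hasMFDerivAt hφd
    have h2 := HasMFDerivAt.comp x (((hb.contDiffAt (ψ.open_source.mem_nhds hcx)).differentiableAt
      (by simp)).hasFDerivAt.hasMFDerivAt)
      ((mdifferentiable_chartAt (𝕜 := 𝕜) x₀).mdifferentiableAt hxc).hasMFDerivAt
    -- Both sides are the transverse coordinate b; the chain rule then identifies dπ ∘ dφ with db,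
    -- which turns the Liouville form into ξ ∘ db.
    have heq : (fun y => (e (c.symm y)).2) ∘ c =ᶠ[𝓝 x] CotangentBundle.proj ∘ φ := by
      filter_upwards [φ.open_source.mem_nhds hx] with z hz
      have hzc : z ∈ c.source := (hφs ▸ hz : z ∈ (c.trans ψ).source).1
      simp only [Function.comp_apply, c.left_inv hzc]
      exact (hφ1 z hz).symm
    have h3 := congrArg (fun L => L v)
      (hasMFDerivAt_unique h1 (h2.congr_of_eventuallyEq heq.symm))
    rw [← oneFormInChart_mfderiv S.form x₀ hxc v, hA _ hcx]
    exact (congrArg (φ x).2 h3).trans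
      (congrArg (fun L : (Fin q → 𝕜) →L[𝕜] 𝕜 => L (fderiv 𝕜 (fun y => (e (c.symm y)).2) (c x)
        (mfderiv 𝓘(𝕜, E) 𝓘(𝕜, E) c x v))) (hφ2 x))
  · refine fun x hx => F.image_leafIn_eq he φ CotangentBundle.proj hφe hφ1 (fun s => ?_) hx
    have hfib : {ζ ∈ φ.target | CotangentBundle.proj ζ = s} =
        t.toOpenPartialHomeomorph.symm '' (ψ.target ∩ {g | g.1 = s}) := by
      ext ζ
      constructor
      · intro hζ
        refine ⟨t ζ, ⟨(hφt ζ).1 hζ.1, ?_⟩, t.toOpenPartialHomeomorph.left_inv (hts ▸ mem_univ ζ)⟩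
        rw [htapp]
        exact hζ.2
      · rintro ⟨g, hg, rfl⟩
        refine ⟨(hφt _).2 (by rw [htsymm]; exact hg.1), ?_⟩
        exact (congrArg Prod.fst ((htapp _).symm.trans (htsymm g))).trans hg.2
    -- A ball cut by an affine subspace is convex; convexity is taken over ℝ, also when `𝕜 = ℂ`.
    have hpre : IsPreconnected (ψ.target ∩ {g | g.1 = s}) := by
      rw [hψt]
      exact ((convex_ball _ r).inter ((convex_singleton s).linear_preimage
        (LinearMap.fst ℝ (Fin q → 𝕜) ((Fin q → 𝕜) →L[𝕜] 𝕜)))).isPreconnected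
    rw [hfib]
    refine hpre.image _ (t.toOpenPartialHomeomorph.continuousOn_symm.mono fun g _ => ?_)
    exact htt.symm ▸ mem_univ g
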